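/- Let $(\Omega,\mathcal F,\mathbb P)$ be a probability space and let $K=\prod_{j=1}^d[a_j,b_j]\subset\mathbb R^d$ be a compact interval. A complex random variable $Z$ is called sub-Gaussian with parameter $s\ge 0$ if $\mathbb E\,e^{\mathrm{Re}(\bar zZ)}\le e^{s^2|z|^2/2}$ for all $z\in\mathbb C$. Let $(g_n)_{n\ge1}$ be independent symmetric complex random variables that are sub-Gaussian with parameter $1$, and let $(W_n)_{n\ge1}$ be complex-valued random fields on $K$ with (almost surely) continuous sample paths such that, for every $x\in K$, almost surely $\sum_{n\ge1}|W_n(x)|^2<\infty$. Assume that the sequences $(g_n)_{n\ge1}$ and $(W_n)_{n\ge1}$ are independent of each other. Put $$S_N(x)=\sum_{n=1}^N W_n(x)g_n\quad(N\ge0),\qquad s(x,y)=\Big(\sum_{n\ge1}|W_n(x)-W_n(y)|^2\Big)^{1/2}\in[0,\infty],$$ and let $S(x)=\sum_{n\ge1}W_n(x)g_n$ be the limit of $S_N(x)$ wherever it exists (and some fixed constant elsewhere). Let $\rho:\mathbb R^d\times\mathbb R^d\to[0,\infty)$ be a continuous quasi-metric, i.e. $\rho(x,y)=0$ iff $x=y$,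 $\rho(x,y)=\rho(y,x)$, and $\rho(x,z)\le\kappa(\rho(x,y)+\rho(y,z))$ for some constant $\kappa\ge1$. Assume that there are constants $0<\underline H\le\overline H\le1$ and $c_1,c_2\in(0,\infty)$ such that, for the Euclidean norm, $$c_1\|x-y\|^{\overline H}\le\rho(x,y)\le c_2\|x-y\|^{\underline H}\qquad\text{whenever }\|x-y\|\le1.$$ For $x_0\in K$ and $r>0$ let $B(x_0,r)=\{z\in\mathbb R^d:\|z-x_0\|\le r\}$. For $\beta\in(0,1]$ and $\eta\in\mathbb R$ let $\mathcal H_{\rho,K}(x_0,\beta,\eta)$ be the set of functions $f:K\to\mathbb C$ for which there are $r\in(0,1)$ and $c\in(0,\infty)$ with $|f(x)-f(y)|\le c\,\rho(x,y)^\beta|\log\rho(x,y)|^\eta$ for all $x,y\in B(x_0,r)\cap K$. Here and below $h^\beta|\log h|^\eta$ is read as $0$ at $h=0$, and as $+\infty$ at $h=1$ if $\eta<0$. Fix $x_0\in K$ and assume that there are random variables $\gamma>0$, $\beta\in(0,1]$, $\eta\in\mathbb R$ and $C\in(0,\infty)$ such that, almost surely, $$s(x,y)\le C\rho(x,y)^{\beta}|\log\rho(x,y)|^{\eta}\qquad\text{for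 all }x,y\in B(x_0,\gamma)\cap K.$$ Then for every $x\in K$ the sequence $S_N(x)$ converges almost surely to $S(x)$. Moreover, almost surely, there exist $\gamma^*\in(0,\gamma)$ and $C^*\in(0,\infty)$ such that $$\sup_{N\ge0}|S_N(x)-S_N(y)|\le C^*\rho(x,y)^{\beta}|\log\rho(x,y)|^{\eta+1/2}\qquad\text{for all }x,y\in B(x_0,\gamma^*)\cap K,$$ and $(S_N)_{N\ge0}$ converges uniformly on $B(x_0,\gamma^*)\cap K$ to $S$. Almost surely the limit $S$ belongs to $\mathcal H_{\rho,K}(x_0,\beta,\eta+1/2)$; in particular, almost surely $S$ is continuous at $x_0$ (as a function on $K$). -/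

import Mathlib

open MeasureTheory ProbabilityTheory Filter Topology
open scoped ENNReal

namespace CondSubGaussian

noncomputable section

/-- A complex random variable `Z` is sub-Gaussian with parameter `s ∈ [0, ∞)`:
`E exp (Re (conj z * Z)) ≤ exp (s² |z|² / 2)` for all complex `z`
(finiteness of the expectation is part of the claim). -/
def IsSubGaussian {Ω : Type*} [MeasurableSpace Ω] (μ : Measure Ω) (Z : Ω → ℂ) (s : ℝ) : Prop :=
  0 ≤ s ∧ ∀ z : ℂ,
    Integrable (fun ω => Real.exp ((starRingEnd ℂ z * Z ω).re)) μ ∧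
      ∫ ω, Real.exp ((starRingEnd ℂ z * Z ω).re) ∂μ ≤ Real.exp (s ^ 2 * ‖z‖ ^ 2 / 2)

/-- The compact interval `∏ j, [a j, b j]` of Euclidean space. -/
def box {d : ℕ} (a b : Fin d → ℝ) : Set (EuclideanSpace ℝ (Fin d)) :=
  {x | ∀ j, x j ∈ Set.Icc (a j) (b j)}

/-- Continuous quasi-metrics on `ℝ^d`. -/
structure IsQuasiMetric {d : ℕ}
    (ρ : EuclideanSpace ℝ (Fin d) → EuclideanSpace ℝ (Fin d) → ℝ) : Prop where
  continuous : Continuous (fun p : EuclideanSpace ℝ (Fin d) × EuclideanSpace ℝ (Fin d) => ρ p.1 p.2)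
  nonneg : ∀ x y, 0 ≤ ρ x y
  faithful : ∀ x y, ρ x y = 0 ↔ x = y
  symmetric : ∀ x y, ρ x y = ρ y x
  quasi_triangle : ∃ κ : ℝ, 1 ≤ κ ∧ ∀ x y z, ρ x z ≤ κ * (ρ x y + ρ y z)

/-- Two-sided comparison of `ρ` with powers of the Euclidean distance at distances `≤ 1`. -/
def ComparableToNorm {d : ℕ}
    (ρ : EuclideanSpace ℝ (Fin d) → EuclideanSpace ℝ (Fin d) → ℝ) : Prop :=
  ∃ Hlow Hup c₁ c₂ : ℝ, 0 < Hlow ∧ Hlow ≤ Hup ∧ Hup ≤ 1 ∧ 0 < c₁ ∧ 0 < c₂ ∧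
    ∀ x y, ‖x - y‖ ≤ 1 → c₁ * ‖x - y‖ ^ Hup ≤ ρ x y ∧ ρ x y ≤ c₂ * ‖x - y‖ ^ Hlow

/-- The modulus `h ^ β * |log h| ^ η`, for `h ≥ 0` and `β > 0`, with values in `[0, ∞]`:
it is `0` at `h = 0`, and at `h = 1` it is `∞` when `η < 0`. -/
def logModulus (β η h : ℝ) : ℝ≥0∞ :=
  ENNReal.ofReal h ^ β * ENNReal.ofReal |Real.log h| ^ η

/-- The local regularity class `H_{ρ,K}(x₀, β, η)`, for complex-valued functions on `K`.
`Metric.closedBall x₀ γ` is the set of the `z ∈ K` with `‖z - x₀‖ ≤ γ`. -/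
def LocalRegularity {d : ℕ} (ρ : EuclideanSpace ℝ (Fin d) → EuclideanSpace ℝ (Fin d) → ℝ)
    (K : Set (EuclideanSpace ℝ (Fin d))) (x₀ : K) (β η : ℝ) : Set (K → ℂ) :=
  {f | ∃ γ C : ℝ, 0 < γ ∧ γ < 1 ∧ 0 < C ∧
    ∀ x ∈ Metric.closedBall x₀ γ, ∀ y ∈ Metric.closedBall x₀ γ,
      ‖f x - f y‖ₑ ≤ ENNReal.ofReal C * logModulus β η (ρ x y)}

/-- The conditional parameter `s(x, y) = (∑ n, |W_n(x) - W_n(y)|²)^(1/2)`, with values in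
`[0, ∞]`. -/
def condParam {Ω X : Type*} (W : ℕ → X → Ω → ℂ) (ω : Ω) (x y : X) : ℝ≥0∞ :=
  (∑' n, ‖W n x ω - W n y ω‖ₑ ^ 2) ^ (1 / 2 : ℝ)

/-- The sum of the first `N` terms `W_n(x) g_n`; sequences are indexed from `0`. -/
def partialSum {Ω X : Type*} (W : ℕ → X → Ω → ℂ) (g : ℕ → Ω → ℂ) (N : ℕ) (x : X) (ω : Ω) : ℂ :=
  ∑ n ∈ Finset.range N, W n x ω * g n ω

/-- The sum `S(x)` of the series: the limit of the partial sums (some fixed number where they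
diverge). -/
def seriesSum {Ω X : Type*} (W : ℕ → X → Ω → ℂ) (g : ℕ → Ω → ℂ) (x : X) (ω : Ω) : ℂ :=
  limUnder atTop (fun N => partialSum W g N x ω)

end

end CondSubGaussian

open CondSubGaussian

/-! Given the fields `W`, an increment `S_N(x) - S_N(y)` is a weighted sum of independent
sub-Gaussian variables whose weights have `ℓ²` norm at most `s(x, y)`. Exponentials of such sums,
suitably normalised, are nonnegative supermartingales. Ville's inequality therefore bounds all `N`
at once, with tail `4 exp(-t²/4)` at level `t s(x, y)` (`measure_exists_lt_enorm_sum_le`), and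
Fubini carries this over to random weights. Applied to tails of the series, the bound also gives
pointwise convergence (`ae_cauchySeq_sum_mul`).

At scale `2⁻ⁿ` a net of the box needs only exponentially many points in `n`. A union bound and
Borel-Cantelli with `t = A √(n + 1)` control all net increments from some level on
(`ae_eventually_iSup_enorm_partialSum_sub_le`). Since `|log ρ|` is of order `n` at this scale, the
factor `√n` is the extra half power of the logarithm.

The rest is pathwise: for fixed `ω`, chaining through the nets sums a geometrically decaying series
(`exists_local_modulus_of_chaining`). The random `γ, β, η, C` enter only here, as plain numbers. The
chaining error is uniform in `N`, so convergence at finitely many net points becomes uniform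
convergence. -/

open CondSubGaussian

/-! ### Maximal inequalities for deterministic weights -/

section MaximalInequality

variable {Ω : Type*}

/-- The partial products of `Y`, frozen as soon as they reach the level `c`. -/
noncomputable def stoppedProd (Y : ℕ → Ω → ℝ≥0∞) (c : ℝ≥0∞) : ℕ → Ω → ℝ≥0∞
  | 0 => fun _ => 1
  | N + 1 => fun ω =>
      stoppedProd Y c N ω * (if c ≤ stoppedProd Y c N ω then 1 else Y N ω)

lemma stoppedProd_eq_or (Y : ℕ → Ω → ℝ≥0∞) (c : ℝ≥0∞) (N : ℕ) (ω : Ω) :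
    c ≤ stoppedProd Y c N ω ∨ stoppedProd Y c N ω = ∏ n ∈ Finset.range N, Y n ω := by
  induction N with
  | zero => right; simp [stoppedProd]
  | succ N ih =>
    by_cases h : c ≤ stoppedProd Y c N ω
    · left; simp [stoppedProd, h]
    · right
      rw [Finset.prod_range_succ, ← ih.resolve_left h]
      simp [stoppedProd, h]

lemma le_stoppedProd_of_le_prod (Y : ℕ → Ω → ℝ≥0∞) (c : ℝ≥0∞) (N : ℕ) (ω : Ω)
    (h : c ≤ ∏ n ∈ Finset.range N, Y n ω) : c ≤ stoppedProd Y c N ω := by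
  rcases stoppedProd_eq_or Y c N ω with h' | h'
  · exact h'
  · rwa [h']

/-- Freezing makes the crossing events increase, so the probability of ever crossing is a supremum
of probabilities at fixed times, each open to Markov's inequality. -/
lemma monotone_setOf_le_stoppedProd (Y : ℕ → Ω → ℝ≥0∞) (c : ℝ≥0∞) :
    Monotone fun N => {ω | c ≤ stoppedProd Y c N ω} := by
  refine monotone_nat_of_le_succ fun N ω (h : c ≤ _) => ?_
  change c ≤ stoppedProd Y c (N + 1) ω
  simp [stoppedProd, h]

/-- Only factors of index strictly below `N` are involved, hence independence from `Y N`. -/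
lemma measurable_stoppedProd_iSup (Y : ℕ → Ω → ℝ≥0∞) (c : ℝ≥0∞) (N : ℕ) :
    Measurable[⨆ i ∈ Set.Iio N, MeasurableSpace.comap (Y i) inferInstance]
      (stoppedProd Y c N) := by
  induction N with
  | zero => exact @measurable_const _ _ _ (_) _
  | succ N ih =>
    have h1 : Measurable[⨆ i ∈ Set.Iio (N + 1), MeasurableSpace.comap (Y i) inferInstance]
        (stoppedProd Y c N) :=
      ih.mono (biSup_mono fun i hi => Set.mem_Iio.2 (hi.trans (Nat.lt_succ_self N))) le_rfl
    have h2 : Measurable[⨆ i ∈ Set.Iio (N + 1), MeasurableSpace.comap (Y i) inferInstance]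
        (Y N) :=
      (comap_measurable (Y N)).mono
        (le_biSup (fun i => MeasurableSpace.comap (Y i) inferInstance)
          (Set.mem_Iio.2 (Nat.lt_succ_self N))) le_rfl
    exact h1.mul (Measurable.ite (h1 measurableSet_Ici) measurable_const h2)

variable [MeasurableSpace Ω] {μ : Measure Ω}

lemma measurable_stoppedProd {Y : ℕ → Ω → ℝ≥0∞} (hY : ∀ n, Measurable (Y n)) (c : ℝ≥0∞)
    (N : ℕ) : Measurable (stoppedProd Y c N) :=
  (measurable_stoppedProd_iSup Y c N).mono (iSup₂_le fun i _ => (hY i).comap_le) le_rfl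

/-- The supermartingale step: where `c ≤ Z` nothing changes; on the complement, an event of `m`,
independence factors the integral and `Y` has mean at most one. -/
lemma lintegral_mul_ite_le {Ω : Type*} {m m0 : MeasurableSpace Ω} {μ : Measure Ω}
    {Z Y : Ω → ℝ≥0∞} (hm : m ≤ m0) (hZ : Measurable[m] Z) (hY : Measurable Y)
    (hind : Indep m (MeasurableSpace.comap Y inferInstance) μ) (hint : ∫⁻ ω, Y ω ∂μ ≤ 1)
    (c : ℝ≥0∞) :
    ∫⁻ ω, Z ω * (if c ≤ Z ω then 1 else Y ω) ∂μ ≤ ∫⁻ ω, Z ω ∂μ := by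
  set A : Set Ω := {ω | c ≤ Z ω} with hA
  have hAm : MeasurableSet[m] A := hZ measurableSet_Ici
  have hsplit : ∀ ω, Z ω * (if c ≤ Z ω then 1 else Y ω) =
      A.indicator Z ω + Aᶜ.indicator Z ω * Y ω := by
    intro ω
    by_cases h : c ≤ Z ω <;> simp [hA, h]
  have hindm : Measurable[m] (A.indicator Z) := hZ.indicator hAm
  have hindm' : Measurable[m] (Aᶜ.indicator Z) := hZ.indicator hAm.compl
  have hindm0 : Measurable (A.indicator Z) := hindm.mono hm le_rfl
  calc ∫⁻ ω, Z ω * (if c ≤ Z ω then 1 else Y ω) ∂μ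
      = ∫⁻ ω, A.indicator Z ω ∂μ + ∫⁻ ω, Aᶜ.indicator Z ω * Y ω ∂μ := by
        simp_rw [hsplit]
        exact lintegral_add_left hindm0 _
    _ = ∫⁻ ω, A.indicator Z ω ∂μ + (∫⁻ ω, Aᶜ.indicator Z ω ∂μ) * ∫⁻ ω, Y ω ∂μ := by
        rw [lintegral_mul_eq_lintegral_mul_lintegral_of_independent_measurableSpace hm
          hY.comap_le hind hindm' (comap_measurable Y)]
    _ ≤ ∫⁻ ω, A.indicator Z ω ∂μ + ∫⁻ ω, Aᶜ.indicator Z ω ∂μ := by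
        gcongr
        exact mul_le_of_le_one_right' hint
    _ = ∫⁻ ω, Z ω ∂μ := by
        rw [← lintegral_add_left hindm0]
        simp_rw [Set.indicator_self_add_compl_apply]

lemma lintegral_stoppedProd_le_one [IsProbabilityMeasure μ] {Y : ℕ → Ω → ℝ≥0∞}
    (hY : ∀ n, Measurable (Y n)) (hind : iIndepFun Y μ) (hint : ∀ n, ∫⁻ ω, Y n ω ∂μ ≤ 1)
    (c : ℝ≥0∞) (N : ℕ) : ∫⁻ ω, stoppedProd Y c N ω ∂μ ≤ 1 := by
  induction N with
  | zero => simp [stoppedProd]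
  | succ N ih =>
    have hindep := indep_iSup_of_disjoint (fun i => (hY i).comap_le)
      ((iIndepFun_iff_iIndep _ _ _).1 hind) (S := Set.Iio N) (T := {N}) (by simp)
    rw [iSup_singleton] at hindep
    exact (lintegral_mul_ite_le (iSup₂_le fun i _ => (hY i).comap_le)
      (measurable_stoppedProd_iSup Y c N) (hY N) hindep (hint N) c).trans ih

/-- Ville's maximal inequality for the partial products of independent nonnegative variables of
mean at most one. -/
lemma measure_exists_le_prod_le [IsProbabilityMeasure μ] {Y : ℕ → Ω → ℝ≥0∞}
    (hY : ∀ n, Measurable (Y n)) (hind : iIndepFun Y μ) (hint : ∀ n, ∫⁻ ω, Y n ω ∂μ ≤ 1)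
    {c : ℝ≥0∞} (hc0 : c ≠ 0) (hc : c ≠ ∞) :
    μ {ω | ∃ N, c ≤ ∏ n ∈ Finset.range N, Y n ω} ≤ c⁻¹ := by
  calc μ {ω | ∃ N, c ≤ ∏ n ∈ Finset.range N, Y n ω}
      ≤ μ (⋃ N, {ω | c ≤ stoppedProd Y c N ω}) := by
        refine measure_mono ?_
        rintro ω ⟨N, hN⟩
        exact Set.mem_iUnion.2 ⟨N, le_stoppedProd_of_le_prod Y c N ω hN⟩
    _ = ⨆ N, μ {ω | c ≤ stoppedProd Y c N ω} :=
        (monotone_setOf_le_stoppedProd Y c).measure_iUnion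
    _ ≤ c⁻¹ := by
        refine iSup_le fun N => ?_
        refine (meas_ge_le_lintegral_div (measurable_stoppedProd hY c N).aemeasurable hc0 hc).trans
          ?_
        rw [ENNReal.div_eq_inv_mul]
        exact mul_le_of_le_one_right' (lintegral_stoppedProd_le_one hY hind hint c N)

/-- Exponential tail of the running maximum of a weighted sum of independent sub-Gaussian
variables, in a fixed direction of the complex plane. -/
lemma measure_exists_le_re_sum_le [IsProbabilityMeasure μ] {g : ℕ → Ω → ℂ}
    (hg : ∀ n, Measurable (g n)) (hind : iIndepFun g μ) (hsub : ∀ n, IsSubGaussian μ (g n) 1)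
    {a : ℕ → ℂ} {s : ℝ} (hs : 0 < s) (ha : ∀ N, ∑ n ∈ Finset.range N, ‖a n‖ ^ 2 ≤ s ^ 2)
    {u : ℂ} (hu : ‖u‖ = 1) {τ : ℝ} (hτ : 0 < τ) :
    μ {ω | ∃ N, τ ≤ (u * ∑ n ∈ Finset.range N, a n * g n ω).re} ≤
      ENNReal.ofReal (Real.exp (-(τ ^ 2 / (2 * s ^ 2)))) := by
  -- The Chernoff choice: this `l` minimises `-l τ + l² s² / 2`.
  set l : ℝ := τ / s ^ 2 with hl
  have hlpos : 0 < l := by positivity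
  set φ : ℕ → ℂ → ℝ≥0∞ := fun n w =>
    ENNReal.ofReal (Real.exp (l * (u * (a n * w)).re - l ^ 2 * ‖a n‖ ^ 2 / 2)) with hφ
  have hφm : ∀ n, Measurable (φ n) := fun n => by
    refine ENNReal.measurable_ofReal.comp (Continuous.measurable ?_)
    fun_prop
  have hint : ∀ n, ∫⁻ ω, (φ n ∘ g n) ω ∂μ ≤ 1 := by
    intro n
    set z : ℂ := starRingEnd ℂ (l * (u * a n)) with hz
    have hnz : ‖z‖ ^ 2 = l ^ 2 * ‖a n‖ ^ 2 := by
      rw [hz, RCLike.norm_conj, norm_mul, norm_mul, hu, Complex.norm_real, Real.norm_eq_abs,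
        mul_pow, sq_abs, one_mul]
    have hre : ∀ w : ℂ, (starRingEnd ℂ z * w).re = l * (u * (a n * w)).re := by
      intro w
      rw [hz, Complex.conj_conj, mul_assoc, mul_assoc, Complex.re_ofReal_mul]
    obtain ⟨hi, hle⟩ := (hsub n).2 z
    simp_rw [hre] at hi hle
    have heq : ∀ ω, (φ n ∘ g n) ω = ENNReal.ofReal (Real.exp (l * (u * (a n * g n ω)).re)) *
        ENNReal.ofReal (Real.exp (-(l ^ 2 * ‖a n‖ ^ 2 / 2))) := by
      intro ω
      rw [← ENNReal.ofReal_mul (Real.exp_nonneg _), ← Real.exp_add]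
      rfl
    simp_rw [heq]
    rw [lintegral_mul_const' _ _ ENNReal.ofReal_ne_top,
      ← ofReal_integral_eq_lintegral_ofReal hi (ae_of_all _ fun _ => Real.exp_nonneg _),
      ← ENNReal.ofReal_mul (integral_nonneg fun _ => Real.exp_nonneg _),
      ← ENNReal.ofReal_one]
    refine ENNReal.ofReal_le_ofReal ?_
    calc _ ≤ Real.exp (1 ^ 2 * ‖z‖ ^ 2 / 2) * Real.exp (-(l ^ 2 * ‖a n‖ ^ 2 / 2)) := by gcongr
      _ = 1 := by rw [hnz, ← Real.exp_add, one_pow, one_mul, add_neg_cancel, Real.exp_zero]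
  have key := measure_exists_le_prod_le (μ := μ) (fun n => (hφm n).comp (hg n))
    (hind.comp φ hφm) hint (c := ENNReal.ofReal (Real.exp (τ ^ 2 / (2 * s ^ 2))))
    (by simpa using Real.exp_pos _) ENNReal.ofReal_ne_top
  rw [← ENNReal.ofReal_inv_of_pos (Real.exp_pos _), ← Real.exp_neg] at key
  refine (measure_mono ?_).trans key
  rintro ω ⟨N, hN⟩
  refine ⟨N, ?_⟩
  simp only [Function.comp, hφ]
  rw [← ENNReal.ofReal_prod_of_nonneg (fun _ _ => Real.exp_nonneg _), ← Real.exp_sum]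
  refine ENNReal.ofReal_le_ofReal (Real.exp_le_exp.2 ?_)
  rw [Finset.sum_sub_distrib, ← Finset.mul_sum, ← Complex.re_sum, ← Finset.mul_sum,
    ← Finset.sum_div, ← Finset.mul_sum]
  have h1 : l * τ ≤ l * (u * ∑ n ∈ Finset.range N, a n * g n ω).re := by gcongr
  have h2 : l ^ 2 * ∑ n ∈ Finset.range N, ‖a n‖ ^ 2 / 1 ≤ l ^ 2 * s ^ 2 := by
    simpa using mul_le_mul_of_nonneg_left (ha N) (sq_nonneg l)
  have h3 : τ ^ 2 / (2 * s ^ 2) = l * τ - l ^ 2 * s ^ 2 / 2 := by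
    rw [hl]; field_simp; ring
  simp only [div_one] at h2
  linarith

/-- Four directions suffice to detect the modulus. The loss of `√2` turns the exponent `t²/2` into
`t²/4`, and the number of directions is the factor `4` of the tail. -/
lemma exists_direction_norm_le (w : ℂ) : ∃ u ∈ ({1, -1, Complex.I, -Complex.I} : Finset ℂ),
    ‖w‖ / √2 ≤ (u * w).re := by
  have h : ‖w‖ / √2 ≤ max |w.re| |w.im| := by
    rw [div_le_iff₀ (by positivity), mul_comm]
    exact Complex.norm_le_sqrt_two_mul_max w
  rcases le_max_iff.1 h with h | h
  · rcases le_total 0 w.re with h0 | h0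
    · exact ⟨1, by simp, by simpa [abs_of_nonneg h0] using h⟩
    · exact ⟨-1, by simp, by simpa [abs_of_nonpos h0] using h⟩
  · rcases le_total 0 w.im with h0 | h0
    · exact ⟨-Complex.I, by simp, by simpa [abs_of_nonneg h0] using h⟩
    · exact ⟨Complex.I, by simp, by simpa [abs_of_nonpos h0] using h⟩

/-- Sub-Gaussian tail of the running maximum of `∑ aₙ gₙ`, relative to the `ℓ²` norm of `a`. -/
lemma measure_exists_lt_enorm_sum_le [IsProbabilityMeasure μ] {g : ℕ → Ω → ℂ}
    (hg : ∀ n, Measurable (g n)) (hind : iIndepFun g μ) (hsub : ∀ n, IsSubGaussian μ (g n) 1)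
    (a : ℕ → ℂ) {t : ℝ} (ht : 0 < t) :
    μ {ω | ∃ N, ENNReal.ofReal t * (∑' n, ‖a n‖ₑ ^ 2) ^ (1 / 2 : ℝ) <
        ‖∑ n ∈ Finset.range N, a n * g n ω‖ₑ} ≤
      4 * ENNReal.ofReal (Real.exp (-(t ^ 2 / 4))) := by
  -- The strict inequality makes the event empty in both degenerate cases: the threshold is `∞`, or
  -- both sides are `0`.
  by_cases htop : ∑' n, ‖a n‖ₑ ^ 2 = ∞
  · have : ENNReal.ofReal t * (∑' n, ‖a n‖ₑ ^ 2) ^ (1 / 2 : ℝ) = ∞ := by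
      rw [htop, ENNReal.top_rpow_of_pos (by norm_num), ENNReal.mul_top]
      simpa using ht
    simp_rw [this]
    simp
  by_cases hzero : ∑' n, ‖a n‖ₑ ^ 2 = 0
  · have : ∀ n, a n = 0 := by
      intro n
      simpa using (ENNReal.tsum_eq_zero.1 hzero) n
    simp [this]
  set q : ℝ := (∑' n, ‖a n‖ₑ ^ 2).toReal with hq
  have hqpos : 0 < q := ENNReal.toReal_pos hzero htop
  have hqe : ∑' n, ‖a n‖ₑ ^ 2 = ENNReal.ofReal q := (ENNReal.ofReal_toReal htop).symm
  have hroot : (∑' n, ‖a n‖ₑ ^ 2) ^ (1 / 2 : ℝ) = ENNReal.ofReal (√q) := by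
    rw [hqe, ENNReal.ofReal_rpow_of_pos hqpos, Real.sqrt_eq_rpow]
  have ha : ∀ N, ∑ n ∈ Finset.range N, ‖a n‖ ^ 2 ≤ (√q) ^ 2 := by
    intro N
    rw [Real.sq_sqrt hqpos.le, ← ENNReal.ofReal_le_ofReal_iff hqpos.le, ← hqe,
      ENNReal.ofReal_sum_of_nonneg (fun _ _ => by positivity)]
    refine le_trans (le_of_eq ?_) (ENNReal.sum_le_tsum (Finset.range N))
    refine Finset.sum_congr rfl fun n _ => ?_
    rw [ENNReal.ofReal_pow (norm_nonneg _), ofReal_norm]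
  have hsq : 0 < √q := Real.sqrt_pos.2 hqpos
  have hτ : 0 < t * √q / √2 := by positivity
  set U : Finset ℂ := {1, -1, Complex.I, -Complex.I} with hU
  have hcard : U.card ≤ 4 := Finset.card_le_four
  calc _ ≤ μ (⋃ u ∈ U, {ω | ∃ N, t * √q / √2 ≤ (u * ∑ n ∈ Finset.range N, a n * g n ω).re}) := by
        refine measure_mono ?_
        rintro ω ⟨N, hN⟩
        rw [hroot, ← ENNReal.ofReal_mul ht.le, ← ofReal_norm,
          ENNReal.ofReal_lt_ofReal_iff_of_nonneg (by positivity)] at hN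
        obtain ⟨u, hu, hle⟩ := exists_direction_norm_le (∑ n ∈ Finset.range N, a n * g n ω)
        simp only [Set.mem_iUnion]
        exact ⟨u, hu, N, le_trans (by gcongr) hle⟩
    _ ≤ ∑ u ∈ U, μ {ω | ∃ N, t * √q / √2 ≤ (u * ∑ n ∈ Finset.range N, a n * g n ω).re} :=
        measure_biUnion_finset_le _ _
    _ ≤ ∑ u ∈ U, ENNReal.ofReal (Real.exp (-(t ^ 2 / 4))) := by
        refine Finset.sum_le_sum fun u hu => ?_
        have hu1 : ‖u‖ = 1 := by
          simp only [hU, Finset.mem_insert, Finset.mem_singleton] at hu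
          rcases hu with rfl | rfl | rfl | rfl <;> simp
        refine (measure_exists_le_re_sum_le hg hind hsub hsq ha hu1 hτ).trans (le_of_eq ?_)
        congr 3
        rw [div_pow, mul_pow, Real.sq_sqrt (by norm_num : (0 : ℝ) ≤ 2)]
        field_simp
        norm_num
    _ ≤ 4 * ENNReal.ofReal (Real.exp (-(t ^ 2 / 4))) := by
        rw [Finset.sum_const, nsmul_eq_mul]
        gcongr
        exact_mod_cast hcard

end MaximalInequality

/-! ### Random weights: almost sure convergence and control over nets -/

section RandomCoefficients

variable {Ω : Type*} [MeasurableSpace Ω] {μ : Measure Ω} [IsProbabilityMeasure μ]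

/-- The tail bound of `measure_exists_lt_enorm_sum_le` for random coefficients independent of the
sub-Gaussian sequence. -/
lemma measure_exists_lt_enorm_sum_le_of_indepFun {g V : ℕ → Ω → ℂ}
    (hg : ∀ n, Measurable (g n)) (hind : iIndepFun g μ) (hsub : ∀ n, IsSubGaussian μ (g n) 1)
    (hV : ∀ n, Measurable (V n))
    (hgV : IndepFun (fun ω n => g n ω) (fun ω n => V n ω) μ) {t : ℝ} (ht : 0 < t) :
    μ {ω | ∃ N, ENNReal.ofReal t * (∑' n, ‖V n ω‖ₑ ^ 2) ^ (1 / 2 : ℝ) <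
        ‖∑ n ∈ Finset.range N, V n ω * g n ω‖ₑ} ≤
      4 * ENNReal.ofReal (Real.exp (-(t ^ 2 / 4))) := by
  have hg' : Measurable fun ω n => g n ω := measurable_pi_lambda _ hg
  have hV' : Measurable fun ω n => V n ω := measurable_pi_lambda _ hV
  set B : Set ((ℕ → ℂ) × (ℕ → ℂ)) :=
    {p | ∃ N, ENNReal.ofReal t * (∑' n, ‖p.1 n‖ₑ ^ 2) ^ (1 / 2 : ℝ) <
        ‖∑ n ∈ Finset.range N, p.1 n * p.2 n‖ₑ} with hB
  have hBm : MeasurableSet B := by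
    have hB' : B = ⋃ N, {p | ENNReal.ofReal t * (∑' n, ‖p.1 n‖ₑ ^ 2) ^ (1 / 2 : ℝ) <
        ‖∑ n ∈ Finset.range N, p.1 n * p.2 n‖ₑ} := by
      ext p; simp [hB]
    rw [hB']
    refine MeasurableSet.iUnion fun N => measurableSet_lt ?_ ?_ <;> fun_prop
  have hmap := (indepFun_iff_map_prod_eq_prod_map_map hV'.aemeasurable hg'.aemeasurable).1
    hgV.symm
  have : IsProbabilityMeasure (μ.map fun ω n => V n ω) :=
    Measure.isProbabilityMeasure_map hV'.aemeasurable
  have : IsProbabilityMeasure (μ.map fun ω n => g n ω) :=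
    Measure.isProbabilityMeasure_map hg'.aemeasurable
  calc _ = (μ.map fun ω => ((fun n => V n ω), (fun n => g n ω))) B := by
        rw [Measure.map_apply (hV'.prodMk hg') hBm]
        rfl
    _ = ∫⁻ v, (μ.map fun ω n => g n ω) (Prod.mk v ⁻¹' B) ∂(μ.map fun ω n => V n ω) := by
        rw [hmap, Measure.prod_apply hBm]
    _ ≤ ∫⁻ _, 4 * ENNReal.ofReal (Real.exp (-(t ^ 2 / 4))) ∂(μ.map fun ω n => V n ω) := by
        refine lintegral_mono fun v => ?_
        rw [Measure.map_apply hg' (measurable_prodMk_left hBm)]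
        exact measure_exists_lt_enorm_sum_le hg hind hsub v ht
    _ = _ := by simp

/-- A series `∑ Vₙ gₙ` with independent sub-Gaussian `gₙ` and independent, almost surely
square-summable coefficients converges almost surely. -/
lemma ae_cauchySeq_sum_mul {g V : ℕ → Ω → ℂ}
    (hg : ∀ n, Measurable (g n)) (hind : iIndepFun g μ) (hsub : ∀ n, IsSubGaussian μ (g n) 1)
    (hV : ∀ n, Measurable (V n))
    (hgV : IndepFun (fun ω n => g n ω) (fun ω n => V n ω) μ)
    (hsq : ∀ᵐ ω ∂μ, Summable fun n => ‖V n ω‖ ^ 2) :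
    ∀ᵐ ω ∂μ, CauchySeq fun N => ∑ n ∈ Finset.range N, V n ω * g n ω := by
  -- The event that the series restarted at `M` ever exceeds `k + 1` times the `ℓ²` norm of its
  -- remaining weights.
  set E : ℕ → ℕ → Set Ω := fun k M =>
    {ω | ∃ N, ENNReal.ofReal (k + 1) * (∑' n, ‖V (n + M) ω‖ₑ ^ 2) ^ (1 / 2 : ℝ) <
        ‖∑ n ∈ Finset.range N, V (n + M) ω * g (n + M) ω‖ₑ} with hE
  have hEle : ∀ k M, μ (E k M) ≤ 4 * ENNReal.ofReal (Real.exp (-((k + 1 : ℝ) ^ 2 / 4))) := by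
    intro k M
    have hshift : Measurable fun (w : ℕ → ℂ) (n : ℕ) => w (n + M) :=
      measurable_pi_lambda _ fun n => measurable_pi_apply _
    exact measure_exists_lt_enorm_sum_le_of_indepFun (g := fun n => g (n + M))
      (V := fun n => V (n + M)) (fun n => hg _)
      (hind.precomp (add_left_injective M)) (fun n => hsub _) (fun n => hV _)
      (hgV.comp hshift hshift) (by positivity)
  have hbad : ∀ k, μ {ω | ∀ᶠ M in atTop, ω ∈ E k M} ≤
      4 * ENNReal.ofReal (Real.exp (-((k + 1 : ℝ) ^ 2 / 4))) := by
    intro k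
    have hmono : Monotone fun M₀ => ⋂ M ≥ M₀, E k M := fun i j hij =>
      Set.biInter_subset_biInter_left fun M hM => le_trans hij hM
    calc μ {ω | ∀ᶠ M in atTop, ω ∈ E k M} = μ (⋃ M₀, ⋂ M ≥ M₀, E k M) := by
          congr 1; ext ω; simp [eventually_atTop]
      _ = ⨆ M₀, μ (⋂ M ≥ M₀, E k M) := hmono.measure_iUnion
      _ ≤ _ := iSup_le fun M₀ =>
          (measure_mono (Set.biInter_subset_of_mem (Set.mem_ofPred.2 le_rfl))).trans (hEle k M₀)
  have hlim : Tendsto (fun k : ℕ => 4 * ENNReal.ofReal (Real.exp (-((k + 1 : ℝ) ^ 2 / 4))))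
      atTop (𝓝 0) := by
    have h1 : Tendsto (fun k : ℕ => Real.exp (-((k + 1 : ℝ) ^ 2 / 4))) atTop (𝓝 0) := by
      refine Real.tendsto_exp_neg_atTop_nhds_zero.comp ?_
      refine Tendsto.atTop_div_const (by norm_num) ?_
      exact (tendsto_pow_atTop two_ne_zero).comp
        (tendsto_atTop_add_const_right _ _ tendsto_natCast_atTop_atTop)
    have h2 := (ENNReal.continuous_ofReal.tendsto 0).comp h1
    rw [ENNReal.ofReal_zero] at h2
    simpa using ENNReal.Tendsto.const_mul h2 (Or.inr (by norm_num : (4 : ℝ≥0∞) ≠ ∞))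
  -- Almost surely some `k` admits infinitely many good `M`. This is enough: a single good `M` with
  -- small threshold bounds all later partial sums.
  have hnull : ∀ᵐ ω ∂μ, ∃ k, ¬ ∀ᶠ M in atTop, ω ∈ E k M := by
    rw [ae_iff]
    refine le_antisymm (ge_of_tendsto' hlim fun k => ?_) zero_le
    refine (measure_mono fun ω hω => ?_).trans (hbad k)
    simp only [not_exists, not_not, Set.mem_ofPred_eq] at hω
    exact hω k
  filter_upwards [hnull, hsq] with ω ⟨k, hk⟩ hω
  have hfin : ∑' n, ‖V n ω‖ₑ ^ 2 ≠ ∞ := by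
    have h := hω.tsum_ofReal_ne_top
    convert h using 4 with n
    rw [ENNReal.ofReal_pow (norm_nonneg _), ofReal_norm]
  have htail : Tendsto (fun M => ENNReal.ofReal (k + 1) *
      (∑' n, ‖V (n + M) ω‖ₑ ^ 2) ^ (1 / 2 : ℝ)) atTop (𝓝 0) := by
    have h1 := ENNReal.tendsto_sum_nat_add _ hfin
    have h2 := ((ENNReal.continuous_rpow_const (y := (1 / 2 : ℝ))).tendsto 0).comp h1
    rw [ENNReal.zero_rpow_of_pos (by norm_num)] at h2
    simpa using ENNReal.Tendsto.const_mul h2 (Or.inr ENNReal.ofReal_ne_top)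
  refine Metric.cauchySeq_iff'.2 fun ε hε => ?_
  obtain ⟨M, hM, hMε⟩ := ((not_eventually.1 hk).and_eventually
    (htail.eventually (gt_mem_nhds (ENNReal.ofReal_pos.2 hε)))).exists
  refine ⟨M, fun n hn => ?_⟩
  obtain ⟨j, rfl⟩ := Nat.exists_eq_add_of_le hn
  have hj : ‖∑ n ∈ Finset.range j, V (n + M) ω * g (n + M) ω‖ₑ ≤ _ :=
    not_lt.1 fun h => hM ⟨j, h⟩
  rw [dist_eq_norm, Finset.sum_range_add, add_sub_cancel_left]
  simp_rw [add_comm M]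
  have h := hj.trans_lt hMε
  rwa [← ofReal_norm, ENNReal.ofReal_lt_ofReal_iff hε] at h

/-- Simultaneous control of the increments of the partial sums over finite sets of at most
geometrically growing cardinality. -/
lemma ae_eventually_iSup_enorm_partialSum_sub_le {X : Type*} {g : ℕ → Ω → ℂ}
    {W : ℕ → X → Ω → ℂ} (hg : ∀ n, Measurable (g n)) (hind : iIndepFun g μ)
    (hsub : ∀ n, IsSubGaussian μ (g n) 1) (hW : ∀ n x, Measurable (W n x))
    (hgW : IndepFun (fun ω n => g n ω) (fun ω n x => W n x ω) μ)
    (P : ℕ → Finset (X × X)) {R : ℝ} (hR : 1 ≤ R) (hP : ∀ n, ((P n).card : ℝ) ≤ R ^ (n + 1)) :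
    ∃ A : ℝ, 0 < A ∧ ∀ᵐ ω ∂μ, ∀ᶠ n : ℕ in atTop, ∀ p ∈ P n, ∀ N,
      ‖partialSum W g N p.1 ω - partialSum W g N p.2 ω‖ₑ ≤
        ENNReal.ofReal (A * √(n + 1)) * condParam W ω p.1 p.2 := by
  -- Chosen so that the tail at `A √(n + 1)` is `4 (2R)^-(n+1)`, which beats the cardinality
  -- `R^(n+1)` by a summable factor.
  set A : ℝ := √(4 * Real.log (2 * R)) with hA
  have hlog : 0 < Real.log (2 * R) := Real.log_pos (by linarith)
  have hApos : 0 < A := Real.sqrt_pos.2 (by positivity)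
  refine ⟨A, hApos, ?_⟩
  set F : ℕ → Set Ω := fun n => ⋃ p ∈ P n, {ω | ∃ N,
    ENNReal.ofReal (A * √(n + 1)) * (∑' k, ‖W k p.1 ω - W k p.2 ω‖ₑ ^ 2) ^ (1 / 2 : ℝ) <
      ‖∑ k ∈ Finset.range N, (W k p.1 ω - W k p.2 ω) * g k ω‖ₑ} with hF
  have hFle : ∀ n, μ (F n) ≤ ENNReal.ofReal (4 * (1 / 2 : ℝ) ^ (n + 1)) := by
    intro n
    have hexp : Real.exp (-((A * √(n + 1)) ^ 2 / 4)) = ((2 * R) ^ (n + 1))⁻¹ := by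
      rw [hA, mul_pow, Real.sq_sqrt (by positivity), Real.sq_sqrt (by positivity), Real.exp_neg,
        mul_assoc, mul_div_cancel_left₀ _ (by norm_num : (4 : ℝ) ≠ 0), mul_comm]
      have h := Real.exp_nat_mul (Real.log (2 * R)) (n + 1)
      push_cast at h
      rw [h, Real.exp_log (by linarith)]
    calc μ (F n) ≤ ∑ p ∈ P n, 4 * ENNReal.ofReal (Real.exp (-((A * √(n + 1)) ^ 2 / 4))) := by
          refine (measure_biUnion_finset_le _ _).trans (Finset.sum_le_sum fun p _ => ?_)
          have hdiff : Measurable fun (w : ℕ → X → ℂ) (k : ℕ) => w k p.1 - w k p.2 :=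
            measurable_pi_lambda _ fun k => by fun_prop
          exact measure_exists_lt_enorm_sum_le_of_indepFun hg hind hsub
            (fun k => (hW k p.1).sub (hW k p.2)) (hgW.comp measurable_id hdiff) (by positivity)
      _ = ENNReal.ofReal ((P n).card * (4 * ((2 * R) ^ (n + 1))⁻¹)) := by
          rw [Finset.sum_const, nsmul_eq_mul, hexp, ENNReal.ofReal_mul (by positivity),
            ENNReal.ofReal_mul (by norm_num), ENNReal.ofReal_natCast]
          norm_num
      _ ≤ ENNReal.ofReal (4 * (1 / 2 : ℝ) ^ (n + 1)) := by
          refine ENNReal.ofReal_le_ofReal ?_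
          calc ((P n).card : ℝ) * (4 * ((2 * R) ^ (n + 1))⁻¹)
              ≤ R ^ (n + 1) * (4 * ((2 * R) ^ (n + 1))⁻¹) := by gcongr; exact hP n
            _ = 4 * (1 / 2 : ℝ) ^ (n + 1) := by
              rw [mul_pow, div_pow, one_pow]
              have : R ^ (n + 1) ≠ 0 := by positivity
              field_simp
  have hsum : ∑' n, μ (F n) ≠ ∞ := by
    refine ne_top_of_le_ne_top ?_ (ENNReal.tsum_le_tsum hFle)
    refine Summable.tsum_ofReal_ne_top (Summable.mul_left _ ?_)
    exact (summable_nat_add_iff 1).2 (summable_geometric_of_lt_one (by norm_num) (by norm_num))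
  filter_upwards [ae_eventually_notMem hsum] with ω hω
  filter_upwards [hω] with n hn p hp N
  simp only [hF, Set.mem_iUnion, not_exists] at hn
  have h := not_lt.1 fun h => hn p hp ⟨N, h⟩
  simpa only [partialSum, condParam, ← Finset.sum_sub_distrib, ← sub_mul] using h

end RandomCoefficients

/-! ### The modulus in logarithmic coordinates -/

section LogModulus

/-- The modulus `h ^ β * |log h| ^ η` in the variable `u = - log h`. -/
noncomputable def expModulus (β η u : ℝ) : ℝ := Real.exp (-(β * u)) * u ^ η

lemma expModulus_pos (β η : ℝ) {u : ℝ} (hu : 0 < u) : 0 < expModulus β η u :=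
  mul_pos (Real.exp_pos _) (Real.rpow_pos_of_pos hu _)

lemma logModulus_eq_ofReal_expModulus (β η : ℝ) {h : ℝ} (h0 : 0 < h) (h1 : h < 1) :
    logModulus β η h = ENNReal.ofReal (expModulus β η (-Real.log h)) := by
  have hlog : Real.log h < 0 := Real.log_neg h0 h1
  rw [logModulus, expModulus, abs_of_neg hlog, ENNReal.ofReal_rpow_of_pos h0,
    ENNReal.ofReal_rpow_of_pos (neg_pos.2 hlog), ← ENNReal.ofReal_mul (by positivity),
    Real.rpow_def_of_pos h0]
  congr 3
  ring

/-- The logarithmic derivative is `-β + η / u`, nonpositive once `η ≤ β u`; the proof uses `log t ≤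
t - 1` instead of differentiating. -/
lemma expModulus_anti {β η u v : ℝ} (hβ : 0 ≤ β) (hu : 0 < u) (hη : η ≤ β * u) (huv : u ≤ v) :
    expModulus β η v ≤ expModulus β η u := by
  have hv : 0 < v := hu.trans_le huv
  have hlog : η * Real.log (v / u) ≤ β * (v - u) := by
    have hl0 : 0 ≤ Real.log (v / u) := Real.log_nonneg ((one_le_div hu).2 huv)
    have hl1 : Real.log (v / u) ≤ v / u - 1 := Real.log_le_sub_one_of_pos (by positivity)
    calc η * Real.log (v / u) ≤ β * u * Real.log (v / u) := by gcongr
      _ ≤ β * u * (v / u - 1) := by gcongr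
      _ = β * (v - u) := by field_simp
  rw [Real.log_div hv.ne' hu.ne'] at hlog
  rw [expModulus, expModulus, Real.rpow_def_of_pos hu, Real.rpow_def_of_pos hv, ← Real.exp_add,
    ← Real.exp_add, Real.exp_le_exp]
  linarith

/-- Half of the exponential decay absorbs the power `u ^ η`; the other half is the geometric ratio
that makes chaining sums converge. -/
lemma expModulus_add_nat_mul_le {β η u l : ℝ} (hβ : 0 ≤ β) (hu : 0 < u) (hη : η ≤ β / 2 * u)
    (hl : 0 ≤ l) (k : ℕ) :
    expModulus β η (u + k * l) ≤ expModulus β η u * Real.exp (-(β / 2 * l)) ^ k := by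
  have hsplit : ∀ v, expModulus β η v = Real.exp (-(β / 2 * v)) * expModulus (β / 2) η v := by
    intro v
    rw [expModulus, expModulus, ← mul_assoc, ← Real.exp_add]
    congr 2
    ring
  rw [hsplit (u + k * l), hsplit u, ← Real.exp_nat_mul]
  have h := expModulus_anti (by positivity) hu hη (by simp; positivity : u ≤ u + k * l)
  calc _ ≤ Real.exp (-(β / 2 * (u + k * l))) * expModulus (β / 2) η u := by gcongr
    _ = _ := by
      rw [mul_right_comm, ← Real.exp_add]
      congr 2
      ring

/-- The exponential tolerates a bounded shift and the power a bounded ratio, hence the two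
hypotheses on `U`; `|η|` covers both signs. -/
lemma expModulus_le_mul_of_le {β η u U c : ℝ} (hβ : 0 ≤ β) (hu : 0 < u) (huU : u ≤ U)
    (hUc : U ≤ u + c) (hU2 : U ≤ 2 * u) :
    expModulus β η u ≤ Real.exp (β * c) * 2 ^ |η| * expModulus β η U := by
  have hU : 0 < U := hu.trans_le huU
  have h1 : Real.exp (-(β * u)) ≤ Real.exp (β * c) * Real.exp (-(β * U)) := by
    rw [← Real.exp_add, Real.exp_le_exp]
    have := mul_le_mul_of_nonneg_left hUc hβ
    linarith
  have h2 : u ^ η ≤ 2 ^ |η| * U ^ η := by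
    rcases le_total 0 η with h | h
    · rw [abs_of_nonneg h]
      calc u ^ η ≤ U ^ η := Real.rpow_le_rpow hu.le huU h
        _ ≤ 2 ^ η * U ^ η :=
          le_mul_of_one_le_left (by positivity) (Real.one_le_rpow (by norm_num) h)
    · rw [abs_of_nonpos h]
      have h3 : (U / 2) ^ η = 2 ^ (-η) * U ^ η := by
        rw [Real.div_rpow hU.le (by norm_num), Real.rpow_neg (by norm_num), div_eq_inv_mul]
      rw [← h3]
      exact Real.rpow_le_rpow_of_nonpos (by positivity) (by linarith) h
  calc expModulus β η u
      ≤ (Real.exp (β * c) * Real.exp (-(β * U))) * (2 ^ |η| * U ^ η) := by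
        rw [expModulus]; gcongr
    _ = _ := by rw [expModulus]; ring

end LogModulus

/-! ### Deterministic chaining -/

section Chaining

/-- Chaining along nets of resolution `c₀ 2⁻ⁿ` for a quasi-metric: increments over the nets
controlled by `√n` times a logarithmic modulus yield a local modulus with an additional
`√|log|` and, if the sequence converges on the nets, local uniform convergence. -/
theorem exists_local_modulus_of_chaining {X : Type*} [PseudoMetricSpace X] [DecidableEq X]
    {ρ : X → X → ℝ} (hρ_nonneg : ∀ x y, 0 ≤ ρ x y) (hρ_pos : ∀ x y, x ≠ y → 0 < ρ x y) (hρ_symm : ∀ x y, ρ x y = ρ y x) {κ : ℝ} (hκ : 1 ≤ κ)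
    (hρ_tri : ∀ x y z, ρ x z ≤ κ * (ρ x y + ρ y z)) {x₀ : X}
    (hρ_small : ∀ ε > 0, ∃ δ > 0, ∀ x ∈ Metric.closedBall x₀ δ, ∀ y ∈ Metric.closedBall x₀ δ,
      ρ x y ≤ ε)
    {D : ℕ → Finset X} {π : ℕ → X → X} (hπD : ∀ n x, π n x ∈ D n)
    (hπ : ∀ δ > 0, ∀ᶠ n in atTop, ∀ x, dist (π n x) x ≤ δ) {c₀ : ℝ} (hc₀ : 0 ≤ c₀)
    (hπρ : ∀ᶠ n in atTop, ∀ x, ρ x (π n x) ≤ c₀ * (1 / 2 : ℝ) ^ n)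
    {F : ℕ → X → ℂ} (hF : ∀ N, Continuous (F N)) (hFD : ∀ n, ∀ p ∈ D n, CauchySeq fun N => F N p)
    {s : X → X → ℝ≥0∞} {A : ℝ} (hA : 0 < A)
    (hinc : ∀ᶠ n : ℕ in atTop, ∀ p ∈ D n, ∀ q ∈ D n ∪ D (n + 1), ∀ N,
      ‖F N p - F N q‖ₑ ≤ ENNReal.ofReal (A * √(n + 1)) * s p q)
    {γ β η C : ℝ} (hγ : 0 < γ) (hβ : 0 < β) (hC : 0 < C)
    (hs : ∀ x ∈ Metric.closedBall x₀ γ, ∀ y ∈ Metric.closedBall x₀ γ,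
      s x y ≤ ENNReal.ofReal C * logModulus β η (ρ x y)) :
    ∃ γ' C' : ℝ, 0 < γ' ∧ γ' < γ ∧ γ' < 1 ∧ 0 < C' ∧
      (∀ x ∈ Metric.closedBall x₀ γ', ∀ y ∈ Metric.closedBall x₀ γ', ∀ N,
        ‖F N x - F N y‖ₑ ≤ ENNReal.ofReal C' * logModulus β (η + 1 / 2) (ρ x y)) ∧
      UniformCauchySeqOn F atTop (Metric.closedBall x₀ γ') := by
  -- Two uses of the quasi-triangle inequality join `π m x, x, y, π m y`: `2 c₀` pays for the
  -- projections, `1` for `ρ x y ≤ 2⁻ᵐ`. Below, `u n` is `-log (G 2⁻ⁿ)`.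
  set G : ℝ := κ ^ 2 * (2 * c₀ + 1) with hG
  have hG1 : 1 ≤ G := by
    have : 1 ≤ κ ^ 2 := one_le_pow₀ hκ
    nlinarith
  set c : ℝ := Real.log G with hc
  have hc0 : 0 ≤ c := Real.log_nonneg hG1
  have hl : 0 < Real.log 2 := Real.log_pos (by norm_num)
  set u : ℕ → ℝ := fun n => n * Real.log 2 - c with hu
  have hexpu : ∀ n, Real.exp (-u n) = G * (1 / 2 : ℝ) ^ n := by
    intro n
    rw [hu, neg_sub, Real.exp_sub, hc, Real.exp_log (by linarith), Real.exp_nat_mul,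
      Real.exp_log (by norm_num), one_div, inv_pow]
    rfl
  have hu_tendsto : Tendsto u atTop atTop :=
    tendsto_atTop_add_const_right _ _ (tendsto_natCast_atTop_atTop.atTop_mul_const hl)
  have hu_add : ∀ m k : ℕ, u (m + k) = u m + k * Real.log 2 := by
    intro m k; simp only [hu]; push_cast; ring
  set η' : ℝ := η + 1 / 2 with hη'
  have hlog2 := Real.log_two_gt_d9
  -- a level from which on all estimates are available
  obtain ⟨n₀, hn₀⟩ : ∃ n₀, ∀ n ≥ n₀, (∀ x, dist (π n x) x ≤ γ / 2) ∧
      (∀ x, ρ x (π n x) ≤ c₀ * (1 / 2 : ℝ) ^ n) ∧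
      (∀ p ∈ D n, ∀ q ∈ D n ∪ D (n + 1), ∀ N,
        ‖F N p - F N q‖ₑ ≤ ENNReal.ofReal (A * √(n + 1)) * s p q) ∧
      c + 1 ≤ u n ∧ η / β ≤ u n ∧ η' / (β / 2) ≤ u n := by
    have h := (hπ (γ / 2) (by positivity)).and (hπρ.and (hinc.and
      ((hu_tendsto.eventually_ge_atTop (c + 1)).and
      ((hu_tendsto.eventually_ge_atTop (η / β)).and
        (hu_tendsto.eventually_ge_atTop (η' / (β / 2)))))))
    exact eventually_atTop.1 h
  have hupos : ∀ n ≥ n₀, 1 ≤ u n := fun n hn => by linarith [(hn₀ n hn).2.2.2.1]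
  set B : ℝ := 2 * A * C with hB
  have hBpos : 0 < B := by positivity
  set b : ℕ → ℝ := fun n => B * expModulus β η' (u n) with hb
  have hbnn : ∀ n ≥ n₀, 0 ≤ b n := fun n hn =>
    mul_nonneg hBpos.le (expModulus_pos _ _ (by linarith [hupos n hn])).le
  -- increments over neighbouring points of the nets
  have hstep : ∀ n ≥ n₀, ∀ p ∈ D n, ∀ q ∈ D n ∪ D (n + 1), p ∈ Metric.closedBall x₀ γ →
      q ∈ Metric.closedBall x₀ γ → ρ p q ≤ Real.exp (-u n) → ∀ N, ‖F N p - F N q‖ ≤ b n := by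
    intro n hn p hp q hq hpγ hqγ hpq N
    rcases eq_or_ne p q with rfl | hne
    · simpa using hbnn n hn
    have hun := hupos n hn
    obtain ⟨-, -, hincn, hcu, hηu, -⟩ := hn₀ n hn
    have hρ0 := hρ_pos p q hne
    have hρ1 : ρ p q < 1 := hpq.trans_lt (Real.exp_lt_one_iff.2 (by linarith))
    have hlogρ : u n ≤ -Real.log (ρ p q) := by
      have := Real.log_le_log hρ0 hpq
      rw [Real.log_exp] at this
      linarith
    have hψ : expModulus β η (-Real.log (ρ p q)) ≤ expModulus β η (u n) :=
      expModulus_anti hβ.le (by linarith) ((div_le_iff₀' hβ).1 hηu) hlogρ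
    -- Follows from `c + 1 ≤ u n` and `log 2 > 1/2`.
    have hsqrt : √(n + 1 : ℝ) ≤ 2 * √(u n) := by
      have h4 : (n : ℝ) + 1 ≤ 2 ^ 2 * u n := by
        have h5 : (n : ℝ) * Real.log 2 = u n + c := by simp [hu]
        nlinarith
      calc √(n + 1 : ℝ) ≤ √(2 ^ 2 * u n) := Real.sqrt_le_sqrt h4
        _ = 2 * √(u n) := by rw [Real.sqrt_mul (by norm_num), Real.sqrt_sq (by norm_num)]
    -- Here the exponent of the logarithm gains its `1/2`.
    have hψ' : √(u n) * expModulus β η (u n) = expModulus β η' (u n) := by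
      rw [expModulus, expModulus, hη', Real.rpow_add (by linarith), ← Real.sqrt_eq_rpow]
      ring
    have hψ0 := (expModulus_pos β η (show 0 < u n by linarith)).le
    have h1 : ‖F N p - F N q‖ₑ ≤
        ENNReal.ofReal (A * √(n + 1) * (C * expModulus β η (u n))) := by
      refine (hincn p hp q hq N).trans ?_
      rw [ENNReal.ofReal_mul (by positivity : 0 ≤ A * √(n + 1 : ℝ)), ENNReal.ofReal_mul hC.le]
      gcongr
      refine (hs p hpγ q hqγ).trans ?_
      rw [logModulus_eq_ofReal_expModulus β η hρ0 hρ1]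
      gcongr
    rw [← ofReal_norm, ENNReal.ofReal_le_ofReal_iff (by positivity)] at h1
    calc ‖F N p - F N q‖ ≤ A * √(n + 1) * (C * expModulus β η (u n)) := h1
      _ ≤ A * (2 * √(u n)) * (C * expModulus β η (u n)) := by gcongr
      _ = b n := by simp only [hb, hB]; rw [← hψ']; ring
  set r : ℝ := Real.exp (-(β / 2 * Real.log 2)) with hr
  have hr0 : 0 < r := Real.exp_pos _
  have hr1 : r < 1 := Real.exp_lt_one_iff.2 (by simp; positivity)
  have hgeom : ∀ m ≥ n₀, ∀ k, b (m + k) ≤ b m * r ^ k := by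
    intro m hm k
    simp only [hb, hu_add]
    rw [mul_assoc B]
    refine mul_le_mul_of_nonneg_left ?_ hBpos.le
    exact expModulus_add_nat_mul_le hβ.le (by linarith [hupos m hm])
      ((div_le_iff₀' (by positivity)).1 (hn₀ m hm).2.2.2.2.2) hl.le k
  -- The positive exponent `n₀ + 1` ensures `ρ x y < 1` even if `n₀ = 0`, and forces the scale `m`
  -- chosen below to be at least `n₀`.
  obtain ⟨δ, hδ, hδρ⟩ := hρ_small ((1 / 2 : ℝ) ^ (n₀ + 1)) (by positivity)
  -- Below `γ / 2`, since projections move points by at most `γ / 2` and must stay in the ball of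
  -- radius `γ`.
  obtain ⟨γ', hγ'0, hγ'⟩ := exists_between (show 0 < min (γ / 2) (min δ 1) by positivity)
  rw [lt_min_iff, lt_min_iff] at hγ'
  obtain ⟨hγ'γ, hγ'δ, hγ'1⟩ := hγ'
  have hπball : ∀ n ≥ n₀, ∀ x ∈ Metric.closedBall x₀ γ', π n x ∈ Metric.closedBall x₀ γ := by
    intro n hn x hx
    rw [Metric.mem_closedBall] at hx ⊢
    linarith [dist_triangle (π n x) x x₀, (hn₀ n hn).1 x]
  have hpow : ∀ n, (0 : ℝ) < (1 / 2 : ℝ) ^ n := fun n => by positivity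
  have hκ2 : κ ≤ κ ^ 2 := by nlinarith
  -- the telescoping estimate
  have hchain : ∀ m ≥ n₀, ∀ x ∈ Metric.closedBall x₀ γ', ∀ N,
      ‖F N (π m x) - F N x‖ ≤ b m / (1 - r) := by
    intro m hm x hx N
    have hlim : Tendsto (fun k => F N (π (m + k) x)) atTop (𝓝 (F N x)) := by
      have h1 : Tendsto (fun n => π n x) atTop (𝓝 x) := by
        rw [Metric.tendsto_atTop']
        intro ε hε
        obtain ⟨M, hM⟩ := eventually_atTop.1 (hπ (ε / 2) (by positivity))
        exact ⟨M, fun n hn => (hM n hn.le x).trans_lt (by linarith)⟩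
      have h2 : Tendsto (fun k => m + k) atTop atTop :=
        tendsto_atTop_mono (fun k => Nat.le_add_left k m) tendsto_id
      exact ((hF N).tendsto x).comp (h1.comp h2)
    have h := dist_le_of_le_geometric_of_tendsto₀ r (b m) hr1 (fun k => ?_) hlim
    · simpa [dist_eq_norm] using h
    have hmk : m + k ≥ n₀ := by omega
    rw [dist_eq_norm]
    refine le_trans (hstep (m + k) hmk _ (hπD _ _) _
      (Finset.mem_union_right _ (hπD (m + k + 1) x)) (hπball _ hmk x hx)
      (hπball _ (by omega) x hx) ?_ N) (hgeom m hm k)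
    rw [hexpu]
    have e1 := (hn₀ (m + k) hmk).2.1 x
    have e2 := (hn₀ (m + k + 1) (by omega)).2.1 x
    rw [pow_succ] at e2
    have hp := hpow (m + k)
    calc ρ (π (m + k) x) (π (m + k + 1) x)
        ≤ κ * (ρ (π (m + k) x) x + ρ x (π (m + k + 1) x)) := hρ_tri _ _ _
      _ ≤ κ ^ 2 * (c₀ * (1 / 2 : ℝ) ^ (m + k) + c₀ * (1 / 2 : ℝ) ^ (m + k)) := by
        rw [hρ_symm _ x]
        have := mul_nonneg hc₀ hp.le
        exact mul_le_mul hκ2 (add_le_add e1 (by linarith))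
          (add_nonneg (hρ_nonneg _ _) (hρ_nonneg _ _)) (sq_nonneg κ)
      _ = κ ^ 2 * (2 * c₀) * (1 / 2 : ℝ) ^ (m + k) := by ring
      _ ≤ G * (1 / 2 : ℝ) ^ (m + k) := by rw [hG]; gcongr; linarith
  have h1r : 0 < 1 - r := by linarith
  -- `Q` counts one step between net points and two geometric chains; `E` is the cost of replacing
  -- `u m` by `-log (ρ x y)`, at most `log 2 + c` larger.
  set Q : ℝ := 1 + 2 / (1 - r) with hQ
  have hQpos : 0 < Q := by positivity
  set E : ℝ := Real.exp (β * (Real.log 2 + c)) * 2 ^ |η'| with hE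
  have hEpos : 0 < E := by positivity
  refine ⟨γ', B * Q * E, hγ'0, by linarith, hγ'1, by positivity, ?_, ?_⟩
  · intro x hx y hy N
    rcases eq_or_ne x y with rfl | hne
    · simp
    have hρ0 := hρ_pos x y hne
    have hρn₀ : ρ x y ≤ (1 / 2 : ℝ) ^ (n₀ + 1) :=
      hδρ x (Metric.closedBall_subset_closedBall hγ'δ.le hx) y
        (Metric.closedBall_subset_closedBall hγ'δ.le hy)
    have hρ1 : ρ x y < 1 := hρn₀.trans_lt (pow_lt_one₀ (by norm_num) (by norm_num) (by omega))
    obtain ⟨m, hm1, hm2⟩ := exists_nat_pow_near_of_lt_one hρ0 hρ1.le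
      (by norm_num : (0 : ℝ) < 1 / 2) (by norm_num)
    have hm : m ≥ n₀ := by
      by_contra hlt
      have h1 : (1 / 2 : ℝ) ^ (n₀ + 1) ≤ (1 / 2 : ℝ) ^ (m + 1) :=
        pow_le_pow_of_le_one (by norm_num) (by norm_num) (by omega)
      linarith
    set U : ℝ := -Real.log (ρ x y) with hU
    have hlogpow : ∀ n : ℕ, Real.log ((1 / 2 : ℝ) ^ n) = -(n * Real.log 2) := by
      intro n
      rw [Real.log_pow, one_div, Real.log_inv]
      ring
    have hU1 : U ≤ (m + 1) * Real.log 2 := by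
      have := Real.log_le_log (hpow (m + 1)) hm1.le
      rw [hlogpow] at this
      push_cast at this
      linarith
    have hU2 : m * Real.log 2 ≤ U := by
      have := Real.log_le_log hρ0 hm2
      rw [hlogpow] at this
      linarith
    have hum : m * Real.log 2 = u m + c := by simp [hu]
    have hlog2' := Real.log_two_lt_d9
    have hcu := (hn₀ m hm).2.2.2.1
    have hmid : ‖F N (π m x) - F N (π m y)‖ ≤ b m := by
      refine hstep m hm _ (hπD _ _) _ (Finset.mem_union_left _ (hπD m y)) (hπball m hm x hx)
        (hπball m hm y hy) ?_ N
      rw [hexpu]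
      have e1 := (hn₀ m hm).2.1 x
      have e2 := (hn₀ m hm).2.1 y
      calc ρ (π m x) (π m y) ≤ κ * (ρ (π m x) x + ρ x (π m y)) := hρ_tri _ _ _
        _ ≤ κ * (ρ x (π m x) + κ * (ρ x y + ρ y (π m y))) := by
          rw [hρ_symm _ x]; gcongr; exact hρ_tri _ _ _
        _ ≤ κ * (κ * (c₀ * (1 / 2 : ℝ) ^ m) +
            κ * ((1 / 2 : ℝ) ^ m + c₀ * (1 / 2 : ℝ) ^ m)) := by
          gcongr
          refine e1.trans (le_mul_of_one_le_left ?_ hκ)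
          have := hpow m
          positivity
        _ = G * (1 / 2 : ℝ) ^ m := by rw [hG]; ring
    have htri : ‖F N x - F N y‖ ≤ b m * Q := by
      have hx' := hchain m hm x hx N
      have hy' := hchain m hm y hy N
      rw [norm_sub_rev] at hx'
      have hdec : F N x - F N y = (F N x - F N (π m x)) + (F N (π m x) - F N (π m y)) +
          (F N (π m y) - F N y) := by ring
      have hbQ : b m * Q = b m / (1 - r) + b m + b m / (1 - r) := by rw [hQ]; ring
      rw [hdec, hbQ]
      exact (norm_add₃_le).trans (by gcongr)
    -- The doubling condition `U ≤ 2 u m` holds because `c + 1 ≤ u m` and `log 2 < 1`.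
    have hψ : expModulus β η' (u m) ≤ E * expModulus β η' U :=
      expModulus_le_mul_of_le hβ.le (by linarith) (by linarith) (by linarith) (by linarith)
    rw [logModulus_eq_ofReal_expModulus β η' hρ0 hρ1, ← ENNReal.ofReal_mul (by positivity),
      ← ofReal_norm]
    refine ENNReal.ofReal_le_ofReal (htri.trans ?_)
    calc b m * Q = B * Q * expModulus β η' (u m) := by simp only [hb]; ring
      _ ≤ B * Q * (E * expModulus β η' U) := by gcongr
      _ = _ := by ring
  · rw [Metric.uniformCauchySeqOn_iff]
    intro ε hε
    have hb0 : Tendsto (fun k => b n₀ * r ^ k / (1 - r)) atTop (𝓝 0) := by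
      simpa using ((tendsto_pow_atTop_nhds_zero_of_lt_one hr0.le hr1).const_mul
        (b n₀)).div_const (1 - r)
    -- Fix a level whose chaining error is below `ε / 3` for all `N` and `x`; its finitely many net
    -- points then share one index `M`.
    obtain ⟨k, hk⟩ := (hb0.eventually (gt_mem_nhds (show 0 < ε / 3 by positivity))).exists
    have hbk : b (n₀ + k) / (1 - r) < ε / 3 := lt_of_le_of_lt (by gcongr; exact hgeom n₀ le_rfl k) hk
    have hfin : ∃ M, ∀ p ∈ D (n₀ + k), ∀ i ≥ M, ∀ j ≥ M, dist (F i p) (F j p) < ε / 3 := by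
      have h : ∀ p ∈ D (n₀ + k), ∀ᶠ M in atTop, ∀ i ≥ M, ∀ j ≥ M,
          dist (F i p) (F j p) < ε / 3 := by
        intro p hp
        obtain ⟨M, hM⟩ := Metric.cauchySeq_iff.1 (hFD _ p hp) (ε / 3) (by positivity)
        exact eventually_atTop.2 ⟨M, fun M' hM' i hi j hj =>
          hM i (le_trans hM' hi) j (le_trans hM' hj)⟩
      exact ((Finset.eventually_all _).2 h).exists
    obtain ⟨M, hM⟩ := hfin
    refine ⟨M, fun i hi j hj x hx => ?_⟩
    have h1 := hchain (n₀ + k) (by omega) x hx i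
    have h2 := hchain (n₀ + k) (by omega) x hx j
    have h3 := hM _ (hπD (n₀ + k) x) i hi j hj
    rw [← dist_eq_norm] at h1 h2
    rw [dist_comm] at h1
    linarith [dist_triangle4 (F i x) (F i (π (n₀ + k) x)) (F j (π (n₀ + k) x)) (F j x)]

end Chaining

/-! ### Nets of the box -/

section Nets

/-- Regular grids in a box: `M + 1` points in each direction. -/
lemma exists_finset_box_dist_le {d : ℕ} {a b : Fin d → ℝ} (hab : ∀ j, a j ≤ b j) {M : ℕ}
    (hM : 0 < M) : ∃ D : Finset (box a b), D.card ≤ (M + 1) ^ d ∧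
      ∀ x, ∃ y ∈ D, dist y x ≤ √(∑ j, (b j - a j) ^ 2) / M := by
  classical
  have hMr : (0 : ℝ) < M := by exact_mod_cast hM
  have hmem : ∀ k : Fin d → Fin (M + 1),
      WithLp.toLp 2 (fun j => a j + (k j : ℝ) / M * (b j - a j)) ∈ box a b := by
    intro k j
    have h0 : (0 : ℝ) ≤ (k j : ℝ) / M := by positivity
    have h1 : (k j : ℝ) / M ≤ 1 := by
      rw [div_le_one hMr]
      exact_mod_cast Nat.lt_succ_iff.1 (k j).2
    have h2 := hab j
    constructor
    · simp only
      nlinarith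
    · simp only
      nlinarith
  refine ⟨Finset.univ.image fun k => ⟨_, hmem k⟩, ?_, fun x => ?_⟩
  · refine Finset.card_image_le.trans ?_
    simp
  · have hcoord : ∀ j, ∃ k : Fin (M + 1),
        |a j + (k : ℝ) / M * (b j - a j) - x.1 j| ≤ (b j - a j) / M := by
      intro j
      obtain ⟨h1, h2⟩ := x.2 j
      rcases (hab j).eq_or_lt with h | h
      · exact ⟨0, by simp [show x.1 j = a j by linarith, h]⟩
      have hpos : 0 < b j - a j := by linarith
      set t : ℝ := (x.1 j - a j) / (b j - a j) * M with ht
      have ht0 : 0 ≤ t := mul_nonneg (div_nonneg (by linarith) hpos.le) hMr.le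
      have htM : t ≤ M := mul_le_of_le_one_left hMr.le ((div_le_one hpos).2 (by linarith))
      have hf : ⌊t⌋₊ < M + 1 := by
        have : ⌊t⌋₊ ≤ M := Nat.floor_le_of_le htM
        omega
      refine ⟨⟨⌊t⌋₊, hf⟩, ?_⟩
      have hx : x.1 j = a j + t / M * (b j - a j) := by
        rw [ht]; field_simp; ring
      have h3 := Nat.floor_le ht0
      have h4 := Nat.lt_floor_add_one t
      rw [hx, add_sub_add_left_eq_sub, ← sub_mul, ← sub_div, abs_mul, abs_div, abs_of_pos hpos,
        abs_of_pos hMr, div_mul_eq_mul_div]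
      gcongr
      refine mul_le_of_le_one_left hpos.le (abs_le.2 ⟨?_, ?_⟩) <;> simp only <;> linarith
    choose k hk using hcoord
    refine ⟨⟨_, hmem k⟩, Finset.mem_image_of_mem _ (Finset.mem_univ k), ?_⟩
    have hsqrt : √(∑ j, (b j - a j) ^ 2) / M = √(∑ j, (b j - a j) ^ 2 / (M : ℝ) ^ 2) := by
      rw [← Finset.sum_div, Real.sqrt_div' _ (by positivity), Real.sqrt_sq hMr.le]
    rw [Subtype.dist_eq, EuclideanSpace.dist_eq, hsqrt]
    refine Real.sqrt_le_sqrt (Finset.sum_le_sum fun j _ => ?_)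
    rw [← div_pow, Real.dist_eq]
    exact pow_le_pow_left₀ (abs_nonneg _) (hk j) 2

/-- Nets of a box with geometrically growing cardinality and geometrically decreasing resolution
with respect to `ρ`. -/
lemma exists_nets {d : ℕ} {a b : Fin d → ℝ} (hab : ∀ j, a j ≤ b j)
    {ρ : EuclideanSpace ℝ (Fin d) → EuclideanSpace ℝ (Fin d) → ℝ} (hρ : ComparableToNorm ρ) :
    ∃ (D : ℕ → Finset (box a b)) (π : ℕ → box a b → box a b) (R c₀ : ℝ), 1 ≤ R ∧ 0 ≤ c₀ ∧
      (∀ n, ((D n).card : ℝ) ≤ R ^ (n + 1)) ∧ (∀ n x, π n x ∈ D n) ∧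
      (∀ δ > 0, ∀ᶠ n in atTop, ∀ x, dist (π n x) x ≤ δ) ∧
      ∀ᶠ n in atTop, ∀ x : box a b, ρ x (π n x) ≤ c₀ * (1 / 2 : ℝ) ^ n := by
  obtain ⟨H, H', c₁, c₂, hH, -, -, -, hc₂, hcmp⟩ := hρ
  -- Euclidean mesh of order `2^(-L n)` with `H L ≥ 1` gives `ρ`-mesh of order `2⁻ⁿ`, still with
  -- exponentially many points.
  obtain ⟨L, hL⟩ := exists_nat_gt (1 / H)
  have hLH : 1 ≤ H * L := by
    rw [div_lt_iff₀' hH] at hL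
    exact hL.le
  have hLpos : L ≠ 0 := by
    rintro rfl
    norm_num at hLH
  choose D hDcard hD using fun n : ℕ =>
    exists_finset_box_dist_le hab (M := 2 ^ (L * n)) (by positivity)
  choose π hπD hπ using hD
  set l : ℝ := √(∑ j, (b j - a j) ^ 2) with hl
  have hl0 : 0 ≤ l := Real.sqrt_nonneg _
  have hlim : Tendsto (fun n : ℕ => l / ((2 ^ (L * n) : ℕ) : ℝ)) atTop (𝓝 0) := by
    have h1 : Tendsto (fun n : ℕ => l * ((1 / 2 : ℝ) ^ L) ^ n) atTop (𝓝 0) := by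
      simpa using (tendsto_pow_atTop_nhds_zero_of_lt_one (show (0 : ℝ) ≤ (1 / 2) ^ L by positivity)
        (pow_lt_one₀ (by norm_num) (by norm_num) hLpos)).const_mul l
    refine h1.congr fun n => ?_
    rw [← pow_mul]
    push_cast
    rw [one_div, inv_pow, div_eq_mul_inv]
  have hsmall : ∀ δ > 0, ∀ᶠ n in atTop, ∀ x, dist (π n x) x ≤ δ := by
    intro δ hδ
    filter_upwards [hlim.eventually (gt_mem_nhds hδ)] with n hn x
    exact (hπ n x).trans hn.le
  refine ⟨D, π, 2 ^ ((L + 1) * d), c₂ * l ^ H, one_le_pow₀ (by norm_num), by positivity, ?_, hπD,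
    hsmall, ?_⟩
  · intro n
    have h1 : (2 ^ (L * n) + 1) ^ d ≤ 2 ^ ((L + 1) * d * (n + 1)) := by
      calc (2 ^ (L * n) + 1) ^ d ≤ (2 ^ ((L + 1) * (n + 1))) ^ d := by
            gcongr
            calc 2 ^ (L * n) + 1 ≤ 2 ^ (L * n) + 2 ^ (L * n) := by
                  gcongr; exact Nat.one_le_two_pow
              _ = 2 ^ (L * n + 1) := by ring
              _ ≤ 2 ^ ((L + 1) * (n + 1)) := Nat.pow_le_pow_right (by norm_num) (by nlinarith)
        _ = 2 ^ ((L + 1) * d * (n + 1)) := by rw [← pow_mul]; congr 1; ring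
    rw [← pow_mul]
    exact_mod_cast (hDcard n).trans h1
  · filter_upwards [hsmall 1 one_pos] with n hn x
    have hd : dist (π n x) x ≤ l / ((2 ^ (L * n) : ℕ) : ℝ) := hπ n x
    have h1 : ‖(x : EuclideanSpace ℝ (Fin d)) - π n x‖ = dist (π n x) x := by
      rw [dist_comm, Subtype.dist_eq, dist_eq_norm]
    refine (hcmp _ _ (by rw [h1]; exact hn x)).2.trans ?_
    rw [h1, mul_assoc]
    refine mul_le_mul_of_nonneg_left ?_ hc₂.le
    have hpw : ((1 / 2 : ℝ) ^ (L * n)) ^ H ≤ (1 / 2 : ℝ) ^ n := by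
      rw [← Real.rpow_natCast, ← Real.rpow_natCast, ← Real.rpow_mul (by norm_num)]
      refine Real.rpow_le_rpow_of_exponent_ge (by norm_num) (by norm_num) ?_
      push_cast
      have : (0 : ℝ) ≤ n := by positivity
      nlinarith
    calc dist (π n x) x ^ H ≤ (l * (1 / 2 : ℝ) ^ (L * n)) ^ H := by
          refine Real.rpow_le_rpow dist_nonneg (hd.trans (le_of_eq ?_)) hH.le
          push_cast
          rw [one_div, inv_pow, div_eq_mul_inv]
      _ = l ^ H * ((1 / 2 : ℝ) ^ (L * n)) ^ H := Real.mul_rpow hl0 (by positivity)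
      _ ≤ l ^ H * (1 / 2 : ℝ) ^ n := by gcongr

end Nets

/-! ### The main theorem -/

theorem theorem3p1 {Ω : Type*} [MeasurableSpace Ω] (μ : Measure Ω) [IsProbabilityMeasure μ]
    {d : ℕ} (a b : Fin d → ℝ)
    (g : ℕ → Ω → ℂ) (W : ℕ → box a b → Ω → ℂ)
    -- the sequence of independent symmetric sub-Gaussian variables
    (hg_meas : ∀ n, Measurable (g n))
    (hg_indep : iIndepFun g μ)
    (hg_symm : ∀ n, μ.map (g n) = μ.map (fun ω => -g n ω))
    (hg_sub : ∀ n, IsSubGaussian μ (g n) 1)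
    -- the sequence of continuous random fields
    (hW_meas : ∀ n x, Measurable (W n x))
    (hW_cont : ∀ n, ∀ᵐ ω ∂μ, Continuous (fun x => W n x ω))
    (hW_sq : ∀ x, ∀ᵐ ω ∂μ, Summable (fun n => ‖W n x ω‖ ^ 2))
    -- the two sequences are independent
    (hgW : IndepFun (fun ω n => g n ω) (fun ω n x => W n x ω) μ)
    -- the quasi-metric and the bound on the conditional parameter
    (x₀ : box a b)
    (ρ : EuclideanSpace ℝ (Fin d) → EuclideanSpace ℝ (Fin d) → ℝ)
    (hρ : IsQuasiMetric ρ) (hρ_cmp : ComparableToNorm ρ)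
    (γ β η C : Ω → ℝ)
    (hs : ∀ᵐ ω ∂μ, 0 < γ ω ∧ 0 < β ω ∧ β ω ≤ 1 ∧ 0 < C ω ∧
      ∀ x ∈ Metric.closedBall x₀ (γ ω), ∀ y ∈ Metric.closedBall x₀ (γ ω),
        condParam W ω x y ≤ ENNReal.ofReal (C ω) * logModulus (β ω) (η ω) (ρ x y)) :
    -- the field `S` is well defined
    (∀ x, ∀ᵐ ω ∂μ, Tendsto (fun N => partialSum W g N x ω) atTop (𝓝 (seriesSum W g x ω))) ∧
    ∀ᵐ ω ∂μ,
      (∃ γ' C' : ℝ, 0 < γ' ∧ γ' < γ ω ∧ 0 < C' ∧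
        (∀ x ∈ Metric.closedBall x₀ γ', ∀ y ∈ Metric.closedBall x₀ γ',
          (⨆ N : ℕ, ‖partialSum W g N x ω - partialSum W g N y ω‖ₑ) ≤
            ENNReal.ofReal C' * logModulus (β ω) (η ω + 1 / 2) (ρ x y)) ∧
        TendstoUniformlyOn (fun N x => partialSum W g N x ω) (fun x => seriesSum W g x ω) atTop
          (Metric.closedBall x₀ γ')) ∧
      (fun x => seriesSum W g x ω) ∈ LocalRegularity ρ (box a b) x₀ (β ω) (η ω + 1 / 2) ∧
      ContinuousAt (fun x => seriesSum W g x ω) x₀ := by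
  classical
  have hconv : ∀ x, ∀ᵐ ω ∂μ, CauchySeq fun N => partialSum W g N x ω := by
    intro x
    have hx : Measurable fun (w : ℕ → box a b → ℂ) (n : ℕ) => w n x :=
      measurable_pi_lambda _ fun n => by fun_prop
    exact ae_cauchySeq_sum_mul hg_meas hg_indep hg_sub (fun n => hW_meas n x)
      (hgW.comp measurable_id hx) (hW_sq x)
  refine ⟨fun x => (hconv x).mono fun ω hω => hω.tendsto_limUnder, ?_⟩
  obtain ⟨D, π, R, c₀, hR, hc₀, hcard, hπD, hπ, hπρ⟩ :=
    exists_nets (fun j => (x₀.2 j).1.trans (x₀.2 j).2) hρ_cmp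
  obtain ⟨κ, hκ, htri⟩ := hρ.quasi_triangle
  -- Chaining compares points within a level and with the next level; the number of such pairs is at
  -- most `(2 R³)^(n+1)`.
  obtain ⟨A, hA, hinc⟩ := ae_eventually_iSup_enorm_partialSum_sub_le hg_meas hg_indep hg_sub
    hW_meas hgW (fun n => D n ×ˢ (D n ∪ D (n + 1))) (R := 2 * R ^ 3) (by
      have := one_le_pow₀ hR (n := 3)
      linarith) (fun n => by
      have hR0 : 0 < R := by linarith
      have h1 : ((D n ∪ D (n + 1)).card : ℝ) ≤ R ^ (n + 1) + R ^ (n + 1 + 1) :=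
        le_trans (by exact_mod_cast Finset.card_union_le _ _) (add_le_add (hcard n) (hcard _))
      have h2 : R ^ (n + 1) + R ^ (n + 1 + 1) ≤ 2 ^ (n + 1) * R ^ (2 * (n + 1)) := by
        have h3 : R ^ (n + 1) ≤ R ^ (2 * (n + 1)) := pow_le_pow_right₀ hR (by omega)
        have h4 : R ^ (n + 1 + 1) ≤ R ^ (2 * (n + 1)) := pow_le_pow_right₀ hR (by omega)
        have h5 : (2 : ℝ) ≤ 2 ^ (n + 1) := le_self_pow₀ (by norm_num) (by omega)
        have h6 : 2 * R ^ (2 * (n + 1)) ≤ 2 ^ (n + 1) * R ^ (2 * (n + 1)) := by gcongr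
        linarith
      rw [Finset.card_product, Nat.cast_mul]
      calc ((D n).card : ℝ) * ((D n ∪ D (n + 1)).card : ℝ)
          ≤ R ^ (n + 1) * (2 ^ (n + 1) * R ^ (2 * (n + 1))) := by
            gcongr
            · exact hcard n
            · exact h1.trans h2
        _ = (2 * R ^ 3) ^ (n + 1) := by rw [mul_pow, ← pow_mul]; ring)
  have hnets : ∀ᵐ ω ∂μ, ∀ n, ∀ p ∈ D n, CauchySeq fun N => partialSum W g N p ω :=
    ae_all_iff.2 fun n => (ae_ball_iff (D n).countable_toSet).2 fun p _ => hconv p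
  filter_upwards [hinc, hnets, ae_all_iff.2 hW_cont, hs] with ω hincω hnetsω hWω
    ⟨hγ, hβ, _, hC, hsω⟩
  have hcont : ∀ N, Continuous fun x => partialSum W g N x ω := fun N =>
    continuous_finsetSum _ fun n _ => (hWω n).mul continuous_const
  have hsmall : ∀ ε > 0, ∃ δ > 0, ∀ x ∈ Metric.closedBall x₀ δ, ∀ y ∈ Metric.closedBall x₀ δ,
      ρ x y ≤ ε := by
    intro ε hε
    have h0 : ρ x₀ x₀ = 0 := (hρ.faithful _ _).2 rfl
    obtain ⟨δ, hδ, h⟩ := Metric.continuous_iff.1 hρ.continuous (x₀, x₀) ε hε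
    refine ⟨δ / 2, by positivity, fun x hx y hy => ?_⟩
    rw [Metric.mem_closedBall, Subtype.dist_eq] at hx hy
    have h1 := h (x, y) (by
      rw [Prod.dist_eq]
      exact max_lt (by linarith) (by linarith))
    rw [h0, Real.dist_eq, sub_zero] at h1
    exact (le_abs_self _).trans h1.le
  obtain ⟨γ', C', hγ', hγ'γ, hγ'1, hC', hmod, hcauchy⟩ :=
    exists_local_modulus_of_chaining (ρ := fun x y : box a b => ρ x y)
      (fun x y => hρ.nonneg _ _)
      (fun x y hxy => (hρ.nonneg _ _).lt_of_ne' fun h => hxy (Subtype.ext ((hρ.faithful _ _).1 h)))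
      (fun x y => hρ.symmetric _ _) hκ (fun x y z => htri _ _ _) hsmall hπD hπ hc₀ hπρ
      (F := fun N x => partialSum W g N x ω) hcont hnetsω hA
      (s := condParam W ω)
      (hincω.mono fun n hn p hp q hq N => hn (p, q) (Finset.mk_mem_product hp hq) N)
      hγ hβ hC hsω
  -- For this one `ω`, convergence holds at every point of the ball, with no exceptional set
  -- depending on `x`.
  have hlim : ∀ x ∈ Metric.closedBall x₀ γ',
      Tendsto (fun N => partialSum W g N x ω) atTop (𝓝 (seriesSum W g x ω)) :=
    fun x hx => (hcauchy.cauchySeq hx).tendsto_limUnder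
  have hunif : TendstoUniformlyOn (fun N x => partialSum W g N x ω)
      (fun x => seriesSum W g x ω) atTop (Metric.closedBall x₀ γ') :=
    hcauchy.tendstoUniformlyOn_of_tendsto hlim
  refine ⟨⟨γ', C', hγ', hγ'γ, hC', fun x hx y hy => iSup_le (hmod x hx y hy), hunif⟩,
    ⟨γ', C', hγ', hγ'1, hC', fun x hx y hy => ?_⟩, ?_⟩
  · exact le_of_tendsto' ((hlim x hx).sub (hlim y hy)).enorm (hmod x hx y hy)
  · exact (hunif.continuousOn (Eventually.of_forall fun N => (hcont N).continuousOn).frequently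
      ).continuousAt (Metric.closedBall_mem_nhds x₀ hγ')
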